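/- **Proposition 2.3.** Let $n\in\mathbb N$, and write $B>0$ when $B$ is a positive definite complex $n\times n$ matrix. For $\alpha,z>0$ with $\alpha\neq 1$, and for positive semidefinite complex $n\times n$ matrices $A,B$ with $B>0$, put $$P_\alpha(A,B):=B^{1/2}\bigl(B^{-1/2}AB^{-1/2}\bigr)^{\alpha}B^{1/2},\qquad Q_{\alpha,z}(A,B):=\Bigl(B^{\frac{1-\alpha}{2z}}A^{\frac{\alpha}{z}}B^{\frac{1-\alpha}{2z}}\Bigr)^{z}.$$ For positive semidefinite complex $n\times n$ matrices $X,Y$, the log-majorization $X\prec_{\log}Y$ means that $\prod_{i=1}^k\lambda_i(X)\le\prod_{i=1}^k\lambda_i(Y)$ for $k=1,\dots,n$, with equality for $k=n$, where $\lambda_1(X)\ge\dots\ge\lambda_n(X)$ are the eigenvalues of $X$ in decreasing order counting multiplicities. Let $\alpha>1$ and $z>0$. Let $E$ be an (orthogonal) projection in the complex $n\times n$ matrices and let $B>0$ be such that $EB\neq BE$. Then: (a) $P_\alpha(E,B)\prec_{\log}Q_{\alpha,z}(E,B)$ if and only if $z\le\alpha-1$. (b) $Q_{\alpha,z}(E,B)\prec_{\log}P_\alpha(E,B)$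 if and only if $z\ge\alpha-1$. -/

import Mathlib

open scoped MatrixOrder ComplexOrder

/-- `P_α(A, B) = B^{1/2} (B^{-1/2} A B^{-1/2})^α B^{1/2}`. Real powers of matrices are taken by
the (Mathlib) functional calculus `CFC.rpow`. -/
noncomputable def renyiP {n : ℕ} (α : ℝ) (A B : Matrix (Fin n) (Fin n) ℂ) :
    Matrix (Fin n) (Fin n) ℂ :=
  B ^ (1 / 2 : ℝ) * (B ^ (-(1 / 2) : ℝ) * A * B ^ (-(1 / 2) : ℝ)) ^ α * B ^ (1 / 2 : ℝ)

/-- `Q_{α,z}(A, B) = (B^{(1-α)/(2z)} A^{α/z} B^{(1-α)/(2z)})^z`. -/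
noncomputable def renyiQ {n : ℕ} (α z : ℝ) (A B : Matrix (Fin n) (Fin n) ℂ) :
    Matrix (Fin n) (Fin n) ℂ :=
  (B ^ ((1 - α) / (2 * z)) * A ^ (α / z) * B ^ ((1 - α) / (2 * z))) ^ z

/-- Log-majorization `X ≺_log Y`: both matrices are positive semidefinite, and the products of
their `k` largest eigenvalues satisfy `∏_{i ≤ k} λ_i(X) ≤ ∏_{i ≤ k} λ_i(Y)` for all `k ≤ n`,
with equality for `k = n`. Here `eigenvalues₀` lists the eigenvalues in decreasing order with
multiplicity, indexed from `0`. -/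
def LogMajorized {n : ℕ} (X Y : Matrix (Fin n) (Fin n) ℂ) : Prop :=
  ∃ (hX : X.PosSemidef) (hY : Y.PosSemidef),
    (∀ k : ℕ, k ≤ n →
      ∏ i with i.val < k, hX.isHermitian.eigenvalues₀ i ≤
        ∏ i with i.val < k, hY.isHermitian.eigenvalues₀ i) ∧
    ∏ i, hX.isHermitian.eigenvalues₀ i = ∏ i, hY.isHermitian.eigenvalues₀ i

/-! Up to spectrum, `P_α(E, B)` and `Q_{α,z}(E, B)` are the values at `t = 1` and `t = (α - 1) /
z` of `t ↦ (E B^{-t} E)^{(α - 1) / t}`. For `s ≤ t` the convex function `x ↦ x^{t / s}` vanishes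
at `0`, so Jensen's inequality for the quadratic form of `E B^{-s} E` and the min-max principle
show that every eigenvalue of this family increases with `t`; all determinants vanish because `E`
is singular. Conversely, a log-majorization in the wrong direction makes all eigenvalues equal.
Then Jensen's inequality is an equality on an eigenbasis `u` of `E B^{-s} E`, so that each `E u`
is an eigenvector of `B^{-s}` or zero, and `E` commutes with `B`. -/

open Finset Matrix Module

section Jensen

variable {ι V : Type*} [Fintype ι] [AddCommGroup V] [Module ℝ V] {s : Set V} {f : V → ℝ}
  {w : ι → ℝ} {x : ι → V}

lemma map_sum_le_of_convexOn_of_sum_le_one (hf : ConvexOn ℝ s f) (h0 : 0 ∈ s) (hf0 : f 0 ≤ 0)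
    (hw : ∀ i, 0 ≤ w i) (hw1 : ∑ i, w i ≤ 1) (hx : ∀ i, x i ∈ s) :
    f (∑ i, w i • x i) ≤ ∑ i, w i * f (x i) := by
  have hJensen := hf.map_add_sum_le (t := univ) (w := w) (p := x) (v := 1 - ∑ i, w i) (q := 0)
    (fun i _ ↦ hw i) (sub_add_cancel _ _) (fun i _ ↦ hx i) (sub_nonneg.2 hw1) h0
  simp only [smul_zero, zero_add, smul_eq_mul] at hJensen
  linarith [mul_nonpos_of_nonneg_of_nonpos (sub_nonneg.2 hw1) hf0]

lemma eq_sum_of_strictConvexOn_of_sum_le_one (hf : StrictConvexOn ℝ s f) (h0 : 0 ∈ s)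
    (hf0 : f 0 ≤ 0) (hw : ∀ i, 0 ≤ w i) (hw1 : ∑ i, w i ≤ 1) (hx : ∀ i, x i ∈ s)
    (heq : f (∑ i, w i • x i) = ∑ i, w i * f (x i)) {j : ι} (hj : w j ≠ 0) :
    x j = ∑ i, w i • x i := by
  -- The missing weight `1 - ∑ i, w i` is put on the additional point `0`.
  let w' : Option ι → ℝ := fun o ↦ o.elim (1 - ∑ i, w i) w
  let x' : Option ι → V := fun o ↦ o.elim 0 x
  have hw' : ∀ o, 0 ≤ w' o := Option.rec (sub_nonneg.2 hw1) hw
  have hx' : ∀ o, x' o ∈ s := Option.rec h0 hx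
  have hw'1 : ∑ o, w' o = 1 := by simp [w', Fintype.sum_option]
  have hcenter : ∑ o, w' o • x' o = ∑ i, w i • x i := by simp [w', x', Fintype.sum_option]
  have hJensen : f (∑ o, w' o • x' o) = ∑ o, w' o • f (x' o) := by
    refine (hf.convexOn.map_sum_le (fun o _ ↦ hw' o) hw'1 fun o _ ↦ hx' o).antisymm ?_
    rw [hcenter, heq]
    simpa [w', x', Fintype.sum_option] using
      mul_nonpos_of_nonneg_of_nonpos (sub_nonneg.2 hw1) hf0
  have hpoint := (hf.map_sum_eq_iff' (fun o _ ↦ hw' o) hw'1 fun o _ ↦ hx' o).1 hJensen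
    (some j) (mem_univ _) hj
  rwa [hcenter] at hpoint

end Jensen

section MonotoneSequences

variable {m : ℕ} {a b : Fin m → ℝ}

lemma eq_of_forall_prod_le_of_antitone_of_le (ha : 0 ≤ a) (hb : Antitone b) (hab : a ≤ b)
    (h : ∀ k ≤ m, ∏ i with i.val < k, b i ≤ ∏ i with i.val < k, a i) : a = b := by
  funext j
  refine (hab j).antisymm (not_lt.1 fun hj ↦ ?_)
  let initial : Finset (Fin m) := {i | i.val < j.val + 1}
  have hb_pos : ∀ i ∈ initial, 0 < b i := fun i hi ↦
    ((ha j).trans_lt hj).trans_le (hb (Nat.lt_succ_iff.1 (mem_filter.1 hi).2))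
  have hprod : ∏ i ∈ initial, b i ≤ ∏ i ∈ initial, a i := h (j.val + 1) j.isLt
  have ha_pos : ∀ i ∈ initial, 0 < a i := fun i hi ↦ (ha i).lt_of_ne' fun h0 ↦
    ((prod_pos hb_pos).trans_le hprod).ne' (prod_eq_zero hi h0)
  exact (prod_lt_prod ha_pos (fun i _ ↦ hab i) ⟨j, by simp [initial], hj⟩).not_ge hprod

lemma eq_of_antitone_of_map_univ_eq (ha : Antitone a) (hb : Antitone b)
    (h : univ.val.map a = univ.val.map b) : a = b := by
  rw [Fin.univ_val_map, Fin.univ_val_map, Multiset.coe_eq_coe] at h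
  exact List.ofFn_injective (h.eq_of_sortedGE ha.sortedGE_ofFn hb.sortedGE_ofFn)

end MonotoneSequences

open scoped InnerProductSpace
open RCLike (re)

section DiagonalOperators

variable {𝕜 H ι : Type*} [RCLike 𝕜] [NormedAddCommGroup H] [InnerProductSpace 𝕜 H] [Fintype ι]
  {b : OrthonormalBasis ι 𝕜 H} {a : ι → ℝ} {T : H →ₗ[𝕜] H}

lemma inner_basis_apply_of_diagonal (hT : ∀ i, T (b i) = (a i : 𝕜) • b i) (v : H) (i : ι) :
    ⟪b i, T v⟫_𝕜 = (a i : 𝕜) * ⟪b i, v⟫_𝕜 := by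
  classical
  conv_lhs => rw [← b.sum_repr' v]
  simp [map_sum, map_smul, hT, inner_sum, inner_smul_right, b.inner_eq_ite, mul_comm]

lemma re_inner_apply_self_of_diagonal (hT : ∀ i, T (b i) = (a i : 𝕜) • b i) (v : H) :
    re ⟪v, T v⟫_𝕜 = ∑ i, ‖⟪b i, v⟫_𝕜‖ ^ 2 * a i := by
  rw [← b.sum_inner_mul_inner, map_sum]
  refine sum_congr rfl fun i _ ↦ ?_
  rw [inner_basis_apply_of_diagonal hT, mul_left_comm, RCLike.re_ofReal_mul,
    inner_mul_symm_re_eq_norm, norm_mul, norm_inner_symm v, ← sq, mul_comm]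

lemma map_re_inner_apply_self_le {F : H →ₗ[𝕜] H} {f : ℝ → ℝ} {s : Set ℝ} (hf : ConvexOn ℝ s f)
    (h0 : 0 ∈ s) (hf0 : f 0 ≤ 0) (has : ∀ i, a i ∈ s) (hT : ∀ i, T (b i) = (a i : 𝕜) • b i)
    (hF : ∀ i, F (b i) = (f (a i) : 𝕜) • b i) {v : H} (hv : ‖v‖ ≤ 1) :
    f (re ⟪v, T v⟫_𝕜) ≤ re ⟪v, F v⟫_𝕜 := by
  rw [re_inner_apply_self_of_diagonal hT, re_inner_apply_self_of_diagonal hF]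
  refine map_sum_le_of_convexOn_of_sum_le_one hf h0 hf0 (fun i ↦ by positivity) ?_ has
  rw [b.sum_sq_norm_inner_right]
  exact pow_le_one₀ (norm_nonneg v) hv

lemma apply_eq_smul_of_map_re_inner_apply_self_eq {F : H →ₗ[𝕜] H} {f : ℝ → ℝ} {s : Set ℝ}
    (hf : StrictConvexOn ℝ s f) (h0 : 0 ∈ s) (hf0 : f 0 ≤ 0) (has : ∀ i, a i ∈ s)
    (hT : ∀ i, T (b i) = (a i : 𝕜) • b i) (hF : ∀ i, F (b i) = (f (a i) : 𝕜) • b i) {v : H}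
    (hv : ‖v‖ ≤ 1) (heq : f (re ⟪v, T v⟫_𝕜) = re ⟪v, F v⟫_𝕜) :
    T v = (re ⟪v, T v⟫_𝕜 : 𝕜) • v := by
  have hweights : ∑ i, ‖⟪b i, v⟫_𝕜‖ ^ 2 ≤ 1 := by
    rw [b.sum_sq_norm_inner_right]
    exact pow_le_one₀ (norm_nonneg v) hv
  refine b.repr.injective (PiLp.ext fun i ↦ ?_)
  rw [b.repr_apply_apply, b.repr_apply_apply, inner_basis_apply_of_diagonal hT, inner_smul_right]
  rcases eq_or_ne ⟪b i, v⟫_𝕜 0 with hi | hi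
  · rw [hi, mul_zero, mul_zero]
  · rw [re_inner_apply_self_of_diagonal hT, re_inner_apply_self_of_diagonal hF] at heq
    rw [re_inner_apply_self_of_diagonal hT, eq_sum_of_strictConvexOn_of_sum_le_one hf h0 hf0
      (fun i ↦ by positivity) hweights has heq (j := i) (by simpa using hi)]
    rfl

end DiagonalOperators

section MinMax

variable {𝕜 H : Type*} [RCLike 𝕜] [NormedAddCommGroup H] [InnerProductSpace 𝕜 H] {n : ℕ}

lemma exists_norm_eq_one_inner_eq_zero [FiniteDimensional 𝕜 H] {ι : Type*} [Fintype ι]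
    (x : ι → H) (hcard : Fintype.card ι < finrank 𝕜 H) :
    ∃ v : H, ‖v‖ = 1 ∧ ∀ i, ⟪x i, v⟫_𝕜 = 0 := by
  have hspan : Submodule.span 𝕜 (Set.range x) ≠ ⊤ := fun htop ↦ by
    have := finrank_range_le_card (R := 𝕜) x
    rw [Set.finrank, htop, finrank_top] at this
    exact this.not_gt hcard
  obtain ⟨u, hu, hu0⟩ := Submodule.exists_mem_ne_zero_of_ne_bot
    (mt Submodule.orthogonal_eq_bot_iff.1 hspan)
  refine ⟨((‖u‖⁻¹ : ℝ) : 𝕜) • u, ?_, fun i ↦ ?_⟩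
  · simp [norm_smul, hu0]
  · rw [inner_smul_right, Submodule.inner_right_of_mem_orthogonal
      (Submodule.subset_span (Set.mem_range_self i)) hu, mul_zero]

variable [FiniteDimensional 𝕜 H] {T S : H →ₗ[𝕜] H}

lemma exists_eigenvalues_le_re_inner_and_re_inner_le (hT : T.IsSymmetric)
    (hS : S.IsSymmetric) (hn : finrank 𝕜 H = n) (j : Fin n) :
    ∃ v : H, ‖v‖ = 1 ∧ hT.eigenvalues hn j ≤ re ⟪v, T v⟫_𝕜 ∧
      re ⟪v, S v⟫_𝕜 ≤ hS.eigenvalues hn j := by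
  let b := hT.eigenvectorBasis hn
  let c := hS.eigenvectorBasis hn
  obtain ⟨v, hv, hv_orth⟩ := exists_norm_eq_one_inner_eq_zero (𝕜 := 𝕜)
    (Sum.elim (fun i : Set.Ioi j ↦ b i) fun i : Set.Iio j ↦ c i) (by simp; omega)
  have hweights (d : OrthonormalBasis (Fin n) 𝕜 H) (r : ℝ) : r = ∑ i, ‖⟪d i, v⟫_𝕜‖ ^ 2 * r := by
    rw [← sum_mul, d.sum_sq_norm_inner_right, hv, one_pow, one_mul]
  refine ⟨v, hv, ?_, ?_⟩
  · rw [re_inner_apply_self_of_diagonal (hT.apply_eigenvectorBasis hn),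
      hweights b (hT.eigenvalues hn j)]
    refine sum_le_sum fun i _ ↦ ?_
    rcases le_or_gt i j with hij | hij
    · exact mul_le_mul_of_nonneg_left (hT.eigenvalues_antitone hn hij) (by positivity)
    · simp [b, show ⟪b i, v⟫_𝕜 = 0 from hv_orth (.inl ⟨i, hij⟩)]
  · rw [re_inner_apply_self_of_diagonal (hS.apply_eigenvectorBasis hn),
      hweights c (hS.eigenvalues hn j)]
    refine sum_le_sum fun i _ ↦ ?_
    rcases le_or_gt j i with hij | hij
    · exact mul_le_mul_of_nonneg_left (hS.eigenvalues_antitone hn hij) (by positivity)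
    · simp [c, show ⟪c i, v⟫_𝕜 = 0 from hv_orth (.inr ⟨i, hij⟩)]

end MinMax

section Compression

variable {𝕜 ι : Type*} [RCLike 𝕜] [Fintype ι] {E C M : Matrix ι ι 𝕜} {f : ℝ → ℝ}

lemma posSemidef_compression (hE : IsStarProjection E) (hC : C.PosSemidef) :
    (E * C * E).PosSemidef := by
  simpa only [show Eᴴ = E from hE.isSelfAdjoint] using hC.mul_mul_conjTranspose_same E

lemma commute_of_mul_eq_mul_mul (hE : IsStarProjection E) (hC : C.IsHermitian)
    (h : C * E = E * C * E) : Commute E C := by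
  have hE_adj : Eᴴ = E := hE.isSelfAdjoint
  calc E * C = (C * E)ᴴ := by rw [conjTranspose_mul, hE_adj, hC.eq]
    _ = (E * C * E)ᴴ := by rw [h]
    _ = C * E := by rw [conjTranspose_mul, conjTranspose_mul, hE_adj, hC.eq, ← mul_assoc, h]

variable [DecidableEq ι]

lemma toEuclideanLin_eigenvectorBasis (hM : M.IsHermitian) (i : ι) :
    M.toEuclideanLin (hM.eigenvectorBasis i) =
      (hM.eigenvalues i : 𝕜) • hM.eigenvectorBasis i :=
  (PiLp.ext fun j ↦ congrFun (hM.mulVec_eigenvectorBasis i) j).trans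
    (RCLike.real_smul_eq_coe_smul _ _)

lemma toEuclideanLin_cfc_eigenvectorBasis (hM : M.IsHermitian) (i : ι) :
    (cfc f M).toEuclideanLin (hM.eigenvectorBasis i) =
      (f (hM.eigenvalues i) : 𝕜) • hM.eigenvectorBasis i := by
  have hU : cfc f M * (hM.eigenvectorUnitary : Matrix ι ι 𝕜) =
      (hM.eigenvectorUnitary : Matrix ι ι 𝕜) * diagonal (RCLike.ofReal ∘ f ∘ hM.eigenvalues) := by
    rw [hM.cfc_eq, IsHermitian.cfc, Unitary.conjStarAlgAut_apply, mul_assoc,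
      Unitary.coe_star_mul_self, mul_one]
  ext j
  have hji := congrFun₂ hU j i
  rw [mul_diagonal, mul_comm] at hji
  exact hji

lemma eigenvalues₀_nonneg (hM : M.PosSemidef) : 0 ≤ hM.isHermitian.eigenvalues₀ := fun i ↦ by
  simpa [IsHermitian.eigenvalues] using
    hM.eigenvalues_nonneg (Fintype.equivOfCardEq (Fintype.card_fin _) i)

lemma toEuclideanLin_mul (M N : Matrix ι ι 𝕜) (v : EuclideanSpace 𝕜 ι) :
    (M * N).toEuclideanLin v = M.toEuclideanLin (N.toEuclideanLin v) := by
  simp [toLpLin_mul_same]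

lemma norm_toEuclideanLin_le (hE : IsStarProjection E) (v : EuclideanSpace 𝕜 ι) :
    ‖E.toEuclideanLin v‖ ≤ ‖v‖ := by
  have := (hE.map (toEuclideanCLM (n := ι) (𝕜 := 𝕜))).norm_le
  exact (ContinuousLinearMap.le_of_opNorm_le _ this v).trans (one_mul _).le

lemma inner_toEuclideanLin_compression (hE : IsStarProjection E) (v : EuclideanSpace 𝕜 ι) :
    ⟪v, (E * C * E).toEuclideanLin v⟫_𝕜 =
      ⟪E.toEuclideanLin v, C.toEuclideanLin (E.toEuclideanLin v)⟫_𝕜 := by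
  rw [toEuclideanLin_mul, toEuclideanLin_mul, ← isSymmetric_toEuclideanLin_iff.2 hE.isSelfAdjoint]

lemma map_re_inner_compression_le (hE : IsStarProjection E) (hC : C.PosSemidef)
    (hf : ConvexOn ℝ (Set.Ici 0) f) (hf0 : f 0 ≤ 0) {v : EuclideanSpace 𝕜 ι} (hv : ‖v‖ ≤ 1) :
    f (re ⟪v, (E * C * E).toEuclideanLin v⟫_𝕜) ≤
      re ⟪v, (E * cfc f C * E).toEuclideanLin v⟫_𝕜 := by
  rw [inner_toEuclideanLin_compression hE, inner_toEuclideanLin_compression hE]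
  exact map_re_inner_apply_self_le hf Set.self_mem_Ici hf0 hC.eigenvalues_nonneg
    (toEuclideanLin_eigenvectorBasis hC.isHermitian)
    (toEuclideanLin_cfc_eigenvectorBasis hC.isHermitian) ((norm_toEuclideanLin_le hE v).trans hv)

lemma apply_eq_smul_of_map_re_inner_compression_eq (hE : IsStarProjection E) (hC : C.PosSemidef)
    (hf : StrictConvexOn ℝ (Set.Ici 0) f) (hf0 : f 0 ≤ 0) {v : EuclideanSpace 𝕜 ι} (hv : ‖v‖ ≤ 1)
    (heq : f (re ⟪v, (E * C * E).toEuclideanLin v⟫_𝕜) =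
      re ⟪v, (E * cfc f C * E).toEuclideanLin v⟫_𝕜) :
    C.toEuclideanLin (E.toEuclideanLin v) =
      (re ⟪v, (E * C * E).toEuclideanLin v⟫_𝕜 : 𝕜) • E.toEuclideanLin v := by
  rw [inner_toEuclideanLin_compression hE, inner_toEuclideanLin_compression hE] at heq
  rw [inner_toEuclideanLin_compression hE]
  exact apply_eq_smul_of_map_re_inner_apply_self_eq hf Set.self_mem_Ici hf0 hC.eigenvalues_nonneg
    (toEuclideanLin_eigenvectorBasis hC.isHermitian)
    (toEuclideanLin_cfc_eigenvectorBasis hC.isHermitian) ((norm_toEuclideanLin_le hE v).trans hv)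
    heq

lemma map_eigenvalues₀_compression_le (hE : IsStarProjection E) (hC : C.PosSemidef)
    (hf : ConvexOn ℝ (Set.Ici 0) f) (hf_mono : MonotoneOn f (Set.Ici 0)) (hf0 : f 0 ≤ 0)
    (hG : (E * C * E).IsHermitian) (hF : (E * cfc f C * E).IsHermitian)
    (j : Fin (Fintype.card ι)) :
    f (hG.eigenvalues₀ j) ≤ hF.eigenvalues₀ j := by
  obtain ⟨v, hv, hle, hge⟩ := exists_eigenvalues_le_re_inner_and_re_inner_le
    (isSymmetric_toEuclideanLin_iff.2 hG) (isSymmetric_toEuclideanLin_iff.2 hF)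
    finrank_euclideanSpace j
  have hnonneg : 0 ≤ hG.eigenvalues₀ j :=
    eigenvalues₀_nonneg (posSemidef_compression hE hC) j
  calc f (hG.eigenvalues₀ j) ≤ f (re ⟪v, (E * C * E).toEuclideanLin v⟫_𝕜) :=
        hf_mono hnonneg (hnonneg.trans hle) hle
    _ ≤ re ⟪v, (E * cfc f C * E).toEuclideanLin v⟫_𝕜 :=
        map_re_inner_compression_le hE hC hf hf0 hv.le
    _ ≤ hF.eigenvalues₀ j := hge

lemma commute_of_sum_map_eigenvalues_compression_eq (hE : IsStarProjection E) (hC : C.PosSemidef)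
    (hf : StrictConvexOn ℝ (Set.Ici 0) f) (hf0 : f 0 ≤ 0) (hG : (E * C * E).IsHermitian)
    (h : ∑ i, f (hG.eigenvalues i) = re (E * cfc f C * E).trace) : Commute E C := by
  let u := hG.eigenvectorBasis
  have hGu (i : ι) : re ⟪u i, (E * C * E).toEuclideanLin (u i)⟫_𝕜 = hG.eigenvalues i := by
    rw [toEuclideanLin_eigenvectorBasis, inner_smul_right, inner_self_eq_norm_sq_to_K,
      u.norm_eq_one]
    simp
  have htrace : (E * cfc f C * E).trace =
      ∑ i, ⟪u i, (E * cfc f C * E).toEuclideanLin (u i)⟫_𝕜 := by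
    rw [← LinearMap.trace_eq_sum_inner _ u, toEuclideanLin_eq_toLin_orthonormal, trace_toLin_eq]
  have hJensen (i : ι) : f (re ⟪u i, (E * C * E).toEuclideanLin (u i)⟫_𝕜) ≤
      re ⟪u i, (E * cfc f C * E).toEuclideanLin (u i)⟫_𝕜 :=
    map_re_inner_compression_le hE hC hf.convexOn hf0 (u.norm_eq_one i).le
  have hJensen_eq := (sum_eq_sum_iff_of_le fun i _ ↦ hJensen i).1 (by
    rw [← map_sum, ← htrace, ← h]
    exact sum_congr rfl fun i _ ↦ by rw [hGu])
  have hCE_basis (i : ι) : (C * E).toEuclideanLin (u i) = (E * C * E).toEuclideanLin (u i) := by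
    have heigen := apply_eq_smul_of_map_re_inner_compression_eq hE hC hf hf0
      (u.norm_eq_one i).le (hJensen_eq i (mem_univ i))
    rw [hGu] at heigen
    calc (C * E).toEuclideanLin (u i) = E.toEuclideanLin ((hG.eigenvalues i : 𝕜) • u i) := by
          rw [toEuclideanLin_mul, heigen, map_smul]
      _ = (E * (E * C * E)).toEuclideanLin (u i) := by
          rw [toEuclideanLin_mul, toEuclideanLin_eigenvectorBasis]
      _ = (E * C * E).toEuclideanLin (u i) := by
          rw [mul_assoc, hE.isIdempotentElem.mul_self_mul]
  exact commute_of_mul_eq_mul_mul hE hC.isHermitian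
    (toEuclideanLin.injective (u.toBasis.ext fun i ↦ by simpa using hCE_basis i))

end Compression

section FunctionalCalculus

open Polynomial

variable {𝕜 ι κ : Type*} [RCLike 𝕜] [Fintype ι] [DecidableEq ι] {M N : Matrix ι ι 𝕜}

lemma eigenvalues₀_eq_of_charpoly_eq (hM : M.IsHermitian) (hN : N.IsHermitian)
    (h : M.charpoly = N.charpoly) : hM.eigenvalues₀ = hN.eigenvalues₀ := by
  rw [← List.ofFn_inj, ← hM.sort_roots_charpoly_eq_eigenvalues₀,
    ← hN.sort_roots_charpoly_eq_eigenvalues₀, h]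

lemma prod_eigenvalues₀_eq_zero (hM : M.IsHermitian) (hdet : M.det = 0) :
    ∏ i, hM.eigenvalues₀ i = 0 := by
  rw [hM.det_eq_prod_eigenvalues, ← RCLike.ofReal_prod, RCLike.ofReal_eq_zero] at hdet
  rw [← hdet]
  exact (Equiv.prod_comp (Fintype.equivOfCardEq (Fintype.card_fin _)).symm hM.eigenvalues₀).symm

lemma charpoly_cfc_eq_prod_eigenvalues₀ (hM : M.IsHermitian) (f : ℝ → ℝ) :
    (cfc f M).charpoly = ∏ i, (X - C (f (hM.eigenvalues₀ i) : 𝕜)) := by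
  rw [hM.charpoly_cfc_eq]
  exact Equiv.prod_comp (Fintype.equivOfCardEq (Fintype.card_fin _)).symm
    fun i ↦ X - C (f (hM.eigenvalues₀ i) : 𝕜)

lemma charpoly_cfc_eq_of_charpoly_eq (hM : M.IsHermitian) (hN : N.IsHermitian)
    (h : M.charpoly = N.charpoly) (f : ℝ → ℝ) : (cfc f M).charpoly = (cfc f N).charpoly := by
  rw [hM.charpoly_cfc_eq, hN.charpoly_cfc_eq, (hM.eigenvalues_eq_eigenvalues_iff hN).2 h]

lemma eigenvalues₀_cfc {f : ℝ → ℝ} {s : Set ℝ} (hf : MonotoneOn f s) (hM : M.IsHermitian)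
    (hMs : ∀ i, hM.eigenvalues₀ i ∈ s) (hfM : (cfc f M).IsHermitian) :
    hfM.eigenvalues₀ = f ∘ hM.eigenvalues₀ := by
  refine eq_of_antitone_of_map_univ_eq hfM.eigenvalues₀_antitone
    (fun i j hij ↦ hf (hMs j) (hMs i) (hM.eigenvalues₀_antitone hij))
    (Multiset.map_injective (RCLike.ofReal_injective (K := 𝕜)) ?_)
  have hroots := roots_multiset_prod_X_sub_C (univ.val.map fun i ↦ (f (hM.eigenvalues₀ i) : 𝕜))
  rw [Multiset.map_map] at hroots
  rw [Multiset.map_map, Multiset.map_map, ← hfM.roots_charpoly_eq_eigenvalues₀,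
    charpoly_cfc_eq_prod_eigenvalues₀ hM]
  exact hroots

variable [Fintype κ] [DecidableEq κ]

lemma aeval_mul_eq_mul_aeval {R S : Type*} [CommSemiring R] [Semiring S] [Algebra R S]
    {A : Matrix ι ι S} {B : Matrix κ κ S} {T : Matrix ι κ S} (h : A * T = T * B) (p : R[X]) :
    aeval A p * T = T * aeval B p := by
  have hpow (k : ℕ) : A ^ k * T = T * B ^ k := by
    induction k with
    | zero => simp
    | succ k ih =>
      rw [pow_succ, Matrix.mul_assoc, h, ← Matrix.mul_assoc, ih, Matrix.mul_assoc, ← pow_succ]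
  simp [aeval_eq_sum_range, hpow, Matrix.sum_mul, Matrix.mul_sum]

lemma cfc_mul_eq_mul_cfc {K : Matrix κ κ 𝕜} {T : Matrix ι κ 𝕜} (hM : M.IsHermitian)
    (hK : K.IsHermitian) (h : M * T = T * K) (f : ℝ → ℝ) : cfc f M * T = T * cfc f K := by
  let nodes : Finset ℝ := M.finite_real_spectrum.toFinset ∪ K.finite_real_spectrum.toFinset
  let p : ℝ[X] := Lagrange.interpolate nodes id f
  have hp (x : ℝ) (hx : x ∈ nodes) : f x = p.eval x :=
    (Lagrange.eval_interpolate_at_node (v := id) f (Set.injOn_id _) hx).symm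
  rw [cfc_congr fun x hx ↦ hp x (by simp [nodes, hx]),
    cfc_congr (a := K) fun x hx ↦ hp x (by simp [nodes, hx]),
    cfc_polynomial p M hM.isSelfAdjoint, cfc_polynomial p K hK.isSelfAdjoint,
    aeval_mul_eq_mul_aeval h p]

end FunctionalCalculus

section RealPowers

variable {𝕜 ι κ : Type*} [RCLike 𝕜] [Fintype ι] [DecidableEq ι] [Fintype κ] [DecidableEq κ]
  {E M N : Matrix ι ι 𝕜}

lemma posSemidef_rpow (M : Matrix ι ι 𝕜) (t : ℝ) : (M ^ t).PosSemidef :=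
  nonneg_iff_posSemidef.1 CFC.rpow_nonneg

lemma rpow_mul_eq_mul_rpow {K : Matrix κ κ 𝕜} {T : Matrix ι κ 𝕜} (hM : M.PosSemidef)
    (hK : K.PosSemidef) (h : M * T = T * K) (t : ℝ) : M ^ t * T = T * K ^ t := by
  rw [CFC.rpow_eq_cfc_real hM.nonneg, CFC.rpow_eq_cfc_real hK.nonneg]
  exact cfc_mul_eq_mul_cfc hM.isHermitian hK.isHermitian h _

lemma rpow_mul_self (hM : M.PosSemidef) {t : ℝ} (ht : 0 ≤ t) : M ^ t * M = M ^ (t + 1) := by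
  rw [CFC.rpow_eq_cfc_real hM.nonneg, CFC.rpow_eq_cfc_real hM.nonneg]
  nth_rewrite 2 [← cfc_id ℝ M hM.isHermitian.isSelfAdjoint]
  rw [← cfc_mul _ _ M (M.finite_real_spectrum.continuousOn _)
    (M.finite_real_spectrum.continuousOn _)]
  refine cfc_congr fun x hx ↦ ?_
  simp only [id]
  rw [Real.rpow_add_one' (spectrum_nonneg_of_nonneg hM.nonneg hx) (by positivity)]

lemma commute_rpow (h : Commute M N) (t : ℝ) : Commute (M ^ t) N :=
  h.cfc_nnreal _

lemma mul_conjTranspose_rpow (X : Matrix ι κ 𝕜) {t : ℝ} (ht : 1 ≤ t) :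
    (X * Xᴴ) ^ t = X * (Xᴴ * X) ^ (t - 1) * Xᴴ := by
  have hXX := posSemidef_self_mul_conjTranspose X
  have hXX' := posSemidef_conjTranspose_mul_self X
  calc (X * Xᴴ) ^ t = (X * Xᴴ) ^ (t - 1) * (X * Xᴴ) := by
        rw [rpow_mul_self hXX (sub_nonneg.2 ht), sub_add_cancel]
    _ = X * (Xᴴ * X) ^ (t - 1) * Xᴴ := by
        rw [← Matrix.mul_assoc, rpow_mul_eq_mul_rpow hXX hXX' (Matrix.mul_assoc X Xᴴ X)]

lemma mul_rpow_mul_eq_rpow {S T : Matrix ι ι 𝕜} (hM : M.PosSemidef) (hS : S * M = M)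
    (hT : M * T = M) {t : ℝ} (ht : t ≠ 0) : S * M ^ t * T = M ^ t := by
  have hzero : (0 : Matrix ι ι 𝕜) ^ t = 0 := CFC.zero_rpow ht
  have hleft := rpow_mul_eq_mul_rpow (T := S - 1) .zero hM (by simp [sub_mul, hS]) t
  have hright := rpow_mul_eq_mul_rpow (T := T - 1) hM .zero (by simp [mul_sub, hT]) t
  rw [hzero, zero_mul, sub_mul, one_mul, eq_comm, sub_eq_zero] at hleft
  rw [hzero, mul_zero, mul_sub, mul_one, sub_eq_zero] at hright
  rw [hleft, hright]

lemma rpow_eq_self_of_isStarProjection (hE : IsStarProjection E) {t : ℝ} (ht : t ≠ 0) :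
    E ^ t = E := by
  rw [CFC.rpow_eq_cfc_real hE.nonneg]
  nth_rewrite 2 [← cfc_id ℝ E hE.isSelfAdjoint]
  refine cfc_congr fun x hx ↦ ?_
  rcases hE.isIdempotentElem.spectrum_subset ℝ hx with rfl | rfl
  · exact Real.zero_rpow ht
  · exact Real.one_rpow t

end RealPowers

section CompressedPower

variable {𝕜 ι : Type*} [RCLike 𝕜] [Fintype ι] [DecidableEq ι] {E A C : Matrix ι ι 𝕜}
  {r s t : ℝ}

lemma eigenvalues₀_rpow (hA : A.PosSemidef) (ht : 0 ≤ t) (hAt : (A ^ t).IsHermitian)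
    (i : Fin (Fintype.card ι)) :
    hAt.eigenvalues₀ i = hA.isHermitian.eigenvalues₀ i ^ t := by
  revert hAt
  rw [CFC.rpow_eq_cfc_real hA.nonneg]
  exact fun hAt ↦ congrFun (eigenvalues₀_cfc (Real.monotoneOn_rpow_Ici_of_exponent_nonneg ht)
    hA.isHermitian (eigenvalues₀_nonneg hA) hAt) i

lemma cfc_rpow_div_rpow (hA : A.PosSemidef) (hs : 0 < s) (ht : 0 ≤ t) :
    cfc (fun x : ℝ ↦ x ^ (t / s)) (A ^ s) = A ^ t := by
  rw [← CFC.rpow_eq_cfc_real (posSemidef_rpow A s).nonneg,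
    CFC.rpow_rpow_of_exponent_nonneg A s (t / s) hs.le (by positivity) hA.nonneg,
    mul_div_cancel₀ t hs.ne']

lemma commute_of_commute_rpow (hA : A.PosSemidef) (ht : 0 < t) (h : Commute (A ^ t) C) :
    Commute A C := by
  have hcomm := h.cfc_real fun x ↦ x ^ (1 / t)
  rwa [cfc_rpow_div_rpow hA ht zero_le_one, CFC.rpow_one A hA.nonneg] at hcomm

lemma rpow_div_eigenvalues₀_compression_le (hE : IsStarProjection E) (hA : A.PosSemidef)
    (hs : 0 < s) (hst : s ≤ t) (hG : (E * A ^ s * E).IsHermitian)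
    (hF : (E * A ^ t * E).IsHermitian) (i : Fin (Fintype.card ι)) :
    hG.eigenvalues₀ i ^ (t / s) ≤ hF.eigenvalues₀ i := by
  have hexp : 1 ≤ t / s := (one_le_div hs).2 hst
  revert hF
  rw [← cfc_rpow_div_rpow hA hs (hs.le.trans hst)]
  exact fun hF ↦ map_eigenvalues₀_compression_le hE (posSemidef_rpow A s) (convexOn_rpow hexp)
    (Real.monotoneOn_rpow_Ici_of_exponent_nonneg (by positivity))
    (Real.zero_rpow (by positivity)).le hG hF i

lemma commute_of_rpow_div_eigenvalues₀_compression_eq (hE : IsStarProjection E)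
    (hA : A.PosSemidef) (hs : 0 < s) (hst : s < t) (hG : (E * A ^ s * E).IsHermitian)
    (hF : (E * A ^ t * E).IsHermitian)
    (h : ∀ i, hG.eigenvalues₀ i ^ (t / s) = hF.eigenvalues₀ i) : Commute E A := by
  have hexp : 1 < t / s := (one_lt_div hs).2 hst
  have htrace : ∑ i, hG.eigenvalues i ^ (t / s) =
      re (E * cfc (fun x : ℝ ↦ x ^ (t / s)) (A ^ s) * E).trace := by
    rw [cfc_rpow_div_rpow hA hs (hs.trans hst).le, hF.trace_eq_sum_eigenvalues,
      ← RCLike.ofReal_sum, RCLike.ofReal_re]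
    exact sum_congr rfl fun i _ ↦ h _
  exact (commute_of_commute_rpow hA hs (commute_of_sum_map_eigenvalues_compression_eq hE
    (posSemidef_rpow A s) (strictConvexOn_rpow hexp) (Real.zero_rpow (by positivity)).le hG
    htrace).symm).symm

/-- The family `t ↦ (E A^t E)^{r / t}` interpolating, up to unitary conjugation, between
`P_α(E, B)` at `t = 1` and `Q_{α,z}(E, B)` at `t = (α - 1) / z`, where `A = B⁻¹` and
`r = α - 1`. The value at `t = 0` is meaningless, because of the division by `t`. -/
noncomputable def compressedPower (r : ℝ) (E A : Matrix ι ι 𝕜) (t : ℝ) : Matrix ι ι 𝕜 :=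
  (E * A ^ t * E) ^ (r / t)

lemma compressedPower_posSemidef (r : ℝ) (E A : Matrix ι ι 𝕜) (t : ℝ) :
    (compressedPower r E A t).PosSemidef :=
  posSemidef_rpow _ _

lemma eigenvalues₀_compressedPower (hr : 0 ≤ r) (ht : 0 ≤ t) (hG : (E * A ^ t * E).PosSemidef)
    (i : Fin (Fintype.card ι)) :
    (compressedPower_posSemidef r E A t).isHermitian.eigenvalues₀ i =
      hG.isHermitian.eigenvalues₀ i ^ (r / t) :=
  eigenvalues₀_rpow hG (by positivity) _ i

lemma eigenvalues₀_compressedPower_eq_rpow_rpow (hr : 0 ≤ r) (hs : 0 < s) (ht : 0 < t)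
    (hG : (E * A ^ s * E).PosSemidef) (i : Fin (Fintype.card ι)) :
    (compressedPower_posSemidef r E A s).isHermitian.eigenvalues₀ i =
      (hG.isHermitian.eigenvalues₀ i ^ (t / s)) ^ (r / t) := by
  rw [eigenvalues₀_compressedPower hr hs.le hG, ← Real.rpow_mul (eigenvalues₀_nonneg hG i)]
  congr 1
  field_simp

lemma eigenvalues₀_compressedPower_le (hE : IsStarProjection E) (hA : A.PosSemidef) (hr : 0 ≤ r)
    (hs : 0 < s) (hst : s ≤ t) :
    (compressedPower_posSemidef r E A s).isHermitian.eigenvalues₀ ≤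
      (compressedPower_posSemidef r E A t).isHermitian.eigenvalues₀ := fun i ↦ by
  have ht : 0 < t := hs.trans_le hst
  have hG := posSemidef_compression hE (posSemidef_rpow A s)
  have hF := posSemidef_compression hE (posSemidef_rpow A t)
  rw [eigenvalues₀_compressedPower_eq_rpow_rpow hr hs ht hG,
    eigenvalues₀_compressedPower hr ht.le hF]
  exact Real.rpow_le_rpow (Real.rpow_nonneg (eigenvalues₀_nonneg hG i) _)
    (rpow_div_eigenvalues₀_compression_le hE hA hs hst _ _ i) (by positivity)

lemma commute_of_eigenvalues₀_compressedPower_eq (hE : IsStarProjection E) (hA : A.PosSemidef)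
    (hr : 0 < r) (hs : 0 < s) (hst : s < t)
    (h : (compressedPower_posSemidef r E A s).isHermitian.eigenvalues₀ =
      (compressedPower_posSemidef r E A t).isHermitian.eigenvalues₀) : Commute E A := by
  have ht : 0 < t := hs.trans hst
  have hG := posSemidef_compression hE (posSemidef_rpow A s)
  have hF := posSemidef_compression hE (posSemidef_rpow A t)
  refine commute_of_rpow_div_eigenvalues₀_compression_eq hE hA hs hst hG.isHermitian
    hF.isHermitian fun i ↦ ?_
  have hi := congrFun h i
  rw [eigenvalues₀_compressedPower_eq_rpow_rpow hr.le hs ht hG,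
    eigenvalues₀_compressedPower hr.le ht.le hF] at hi
  exact Real.rpow_left_injOn (by positivity) (Real.rpow_nonneg (eigenvalues₀_nonneg hG i) _)
    (eigenvalues₀_nonneg hF i) hi

lemma det_eq_zero_of_isIdempotentElem (hE : IsIdempotentElem E) (hE1 : E ≠ 1) : E.det = 0 := by
  by_contra hdet
  exact hE1 ((isUnit_iff_isUnit_det E).2 (isUnit_iff_ne_zero.2 hdet) |>.mul_left_cancel
    (hE.eq.trans (mul_one E).symm))

lemma prod_eigenvalues₀_compressedPower (hE : IsStarProjection E) (hE1 : E ≠ 1) (A : Matrix ι ι 𝕜)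
    (hr : 0 < r) (ht : 0 < t) :
    ∏ i, (compressedPower_posSemidef r E A t).isHermitian.eigenvalues₀ i = 0 := by
  have hG := posSemidef_compression hE (posSemidef_rpow A t)
  have hdet : (E * A ^ t * E).det = 0 := by
    simp [det_eq_zero_of_isIdempotentElem hE.isIdempotentElem hE1]
  simp only [eigenvalues₀_compressedPower hr.le ht.le hG]
  rw [Real.finsetProd_rpow _ _ fun i _ ↦ eigenvalues₀_nonneg hG i,
    prod_eigenvalues₀_eq_zero hG.isHermitian hdet, Real.zero_rpow (by positivity)]

end CompressedPower

section LogMajorization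

variable {n : ℕ} {E A X X' Y Y' : Matrix (Fin n) (Fin n) ℂ} {r s t : ℝ}

lemma logMajorized_congr_charpoly (hX : X.PosSemidef) (hY : Y.PosSemidef) (hX' : X'.PosSemidef)
    (hY' : Y'.PosSemidef) (hXX' : X.charpoly = X'.charpoly) (hYY' : Y.charpoly = Y'.charpoly) :
    LogMajorized X Y ↔ LogMajorized X' Y' := by
  simp only [LogMajorized, hX, hY, hX', hY', exists_true_left,
    eigenvalues₀_eq_of_charpoly_eq hX.isHermitian hX'.isHermitian hXX',
    eigenvalues₀_eq_of_charpoly_eq hY.isHermitian hY'.isHermitian hYY']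

lemma logMajorized_of_eigenvalues₀_le (hX : X.PosSemidef) (hY : Y.PosSemidef)
    (hle : hX.isHermitian.eigenvalues₀ ≤ hY.isHermitian.eigenvalues₀)
    (hprod : ∏ i, hX.isHermitian.eigenvalues₀ i = ∏ i, hY.isHermitian.eigenvalues₀ i) :
    LogMajorized X Y :=
  ⟨hX, hY, fun _ _ ↦ prod_le_prod (fun i _ ↦ eigenvalues₀_nonneg hX i) fun i _ ↦ hle i, hprod⟩

lemma LogMajorized.eigenvalues₀_eq_of_le (h : LogMajorized Y X) (hX : X.PosSemidef)
    (hY : Y.PosSemidef) (hle : hX.isHermitian.eigenvalues₀ ≤ hY.isHermitian.eigenvalues₀) :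
    hX.isHermitian.eigenvalues₀ = hY.isHermitian.eigenvalues₀ := by
  obtain ⟨_, _, hprod, -⟩ := h
  exact eq_of_forall_prod_le_of_antitone_of_le (eigenvalues₀_nonneg hX)
    hY.isHermitian.eigenvalues₀_antitone hle fun k hk ↦ hprod k (by simpa using hk)

lemma logMajorized_compressedPower_iff (hE : IsStarProjection E) (hA : A.PosSemidef)
    (hEA : ¬Commute E A) (hr : 0 < r) (hs : 0 < s) (ht : 0 < t) :
    LogMajorized (compressedPower r E A s) (compressedPower r E A t) ↔ s ≤ t := by
  have hF := compressedPower_posSemidef r E A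
  refine ⟨fun h ↦ not_lt.1 fun hts ↦ hEA ?_, fun hst ↦ ?_⟩
  · exact commute_of_eigenvalues₀_compressedPower_eq hE hA hr ht hts <|
      h.eigenvalues₀_eq_of_le (hF t) (hF s) (eigenvalues₀_compressedPower_le hE hA hr.le ht hts.le)
  · have hE1 : E ≠ 1 := fun hE1 ↦ hEA (hE1 ▸ Commute.one_left A)
    exact logMajorized_of_eigenvalues₀_le (hF s) (hF t)
      (eigenvalues₀_compressedPower_le hE hA hr.le hs hst) <| by
        rw [prod_eigenvalues₀_compressedPower hE hE1 A hr hs,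
          prod_eigenvalues₀_compressedPower hE hE1 A hr ht]

end LogMajorization

section Renyi

variable {n : ℕ} {E B : Matrix (Fin n) (Fin n) ℂ} {α z : ℝ}

lemma renyiQ_posSemidef (α z : ℝ) (A B : Matrix (Fin n) (Fin n) ℂ) :
    (renyiQ α z A B).PosSemidef :=
  posSemidef_rpow _ _

lemma renyiP_eq_compressedPower (hα : 1 < α) (hE : IsStarProjection E) (hB : B.PosDef) :
    renyiP α E B = compressedPower (α - 1) E (B ^ (-1 : ℝ)) 1 := by
  set D := B ^ (-(1 / 2) : ℝ) with hD
  have hDB : B ^ (1 / 2 : ℝ) * D = 1 := CFC.rpow_mul_rpow_neg _ hB.isStrictlyPositive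
  have hBD : D * B ^ (1 / 2 : ℝ) = 1 := CFC.rpow_neg_mul_rpow _ hB.isStrictlyPositive
  have hDD : D * D = B ^ (-1 : ℝ) := by
    rw [hD, ← CFC.rpow_add hB.isUnit]
    norm_num
  have hDH : Dᴴ = D := (posSemidef_rpow B _).isHermitian
  have hEE : E * E = E := hE.isIdempotentElem
  have hEH : Eᴴ = E := hE.isSelfAdjoint
  have hXX : D * E * (D * E)ᴴ = D * E * D := by
    rw [conjTranspose_mul, hDH, hEH, ← mul_assoc, mul_assoc D, hEE]
  have hXX' : (D * E)ᴴ * (D * E) = E * B ^ (-1 : ℝ) * E := by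
    rw [conjTranspose_mul, hDH, hEH, ← hDD]
    simp only [mul_assoc]
  have hG : (E * B ^ (-1 : ℝ) * E).PosSemidef := posSemidef_compression hE (posSemidef_rpow B _)
  calc renyiP α E B
      = B ^ (1 / 2 : ℝ) * (D * E * (E * B ^ (-1 : ℝ) * E) ^ (α - 1) * (E * D)) *
          B ^ (1 / 2 : ℝ) := by
        rw [renyiP, ← hD, ← hXX, mul_conjTranspose_rpow _ hα.le, hXX', conjTranspose_mul, hDH, hEH]
    _ = (B ^ (1 / 2 : ℝ) * D) * (E * (E * B ^ (-1 : ℝ) * E) ^ (α - 1) * E) *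
          (D * B ^ (1 / 2 : ℝ)) := by
        simp only [mul_assoc]
    _ = (E * B ^ (-1 : ℝ) * E) ^ (α - 1) := by
        rw [hDB, hBD, one_mul, mul_one, mul_rpow_mul_eq_rpow hG (by simp only [← mul_assoc, hEE])
          (by rw [mul_assoc, hEE]) (sub_pos.2 hα).ne']
    _ = compressedPower (α - 1) E (B ^ (-1 : ℝ)) 1 := by
        rw [compressedPower, CFC.rpow_one _ (posSemidef_rpow B _).nonneg, div_one]

lemma charpoly_renyiQ (hα : 1 < α) (hz : 0 < z) (hE : IsStarProjection E) (hB : B.PosDef) :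
    (renyiQ α z E B).charpoly =
      (compressedPower (α - 1) E (B ^ (-1 : ℝ)) ((α - 1) / z)).charpoly := by
  have hr : α - 1 ≠ 0 := (sub_pos.2 hα).ne'
  set D := B ^ ((1 - α) / (2 * z)) with hD
  have hEE : E * E = E := hE.isIdempotentElem
  have hDD : D * D = (B ^ (-1 : ℝ)) ^ ((α - 1) / z) := by
    rw [hD, ← CFC.rpow_add hB.isUnit, CFC.rpow_rpow B (-1) _ (by norm_num) hB.isStrictlyPositive]
    congr 1
    ring
  have hG := posSemidef_compression hE (posSemidef_rpow (B ^ (-1 : ℝ)) ((α - 1) / z))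
  have hH : (D * E * D).PosSemidef := by
    have hDH : Dᴴ = D := (posSemidef_rpow B _).isHermitian
    simpa only [hDH] using hE.nonneg.posSemidef.mul_mul_conjTranspose_same D
  have hchar : (D * E * D).charpoly = (E * (B ^ (-1 : ℝ)) ^ ((α - 1) / z) * E).charpoly :=
    calc (D * E * D).charpoly = ((D * E) * (E * D)).charpoly := by
          rw [← mul_assoc, mul_assoc D E E, hEE]
      _ = ((E * D) * (D * E)).charpoly := charpoly_mul_comm _ _
      _ = (E * (B ^ (-1 : ℝ)) ^ ((α - 1) / z) * E).charpoly := by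
          rw [← hDD]
          simp only [mul_assoc]
  rw [renyiQ, compressedPower, rpow_eq_self_of_isStarProjection hE (by positivity), ← hD,
    div_div_cancel₀ hr, CFC.rpow_eq_cfc_real hH.nonneg, CFC.rpow_eq_cfc_real hG.nonneg]
  exact charpoly_cfc_eq_of_charpoly_eq hH.isHermitian hG.isHermitian hchar _

lemma commute_of_commute_rpow_neg_one (hB : B.PosDef) (h : Commute E (B ^ (-1 : ℝ))) :
    Commute E B := by
  have hcomm := commute_rpow h.symm (-1)
  rw [CFC.rpow_rpow B (-1) _ (by norm_num) hB.isStrictlyPositive, neg_one_mul, neg_neg,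
    CFC.rpow_one B hB.posSemidef.nonneg] at hcomm
  exact hcomm.symm

end Renyi

theorem proposition2p3 {n : ℕ} (α z : ℝ) (hα : 1 < α) (hz : 0 < z)
    (E B : Matrix (Fin n) (Fin n) ℂ) (hE : IsStarProjection E) (hB : B.PosDef)
    (hEB : E * B ≠ B * E) :
    (LogMajorized (renyiP α E B) (renyiQ α z E B) ↔ z ≤ α - 1) ∧
      (LogMajorized (renyiQ α z E B) (renyiP α E B) ↔ α - 1 ≤ z) := by
  have hr : 0 < α - 1 := sub_pos.2 hα
  have ht : 0 < (α - 1) / z := div_pos hr hz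
  have hA := posSemidef_rpow B (-1)
  have hEA : ¬Commute E (B ^ (-1 : ℝ)) := fun h ↦ hEB (commute_of_commute_rpow_neg_one hB h).eq
  have hC := compressedPower_posSemidef (α - 1) E (B ^ (-1 : ℝ))
  have hQ := renyiQ_posSemidef α z E B
  have hQC := charpoly_renyiQ hα hz hE hB
  rw [renyiP_eq_compressedPower hα hE hB]
  constructor
  · rw [logMajorized_congr_charpoly (hC _) hQ (hC _) (hC _) rfl hQC,
      logMajorized_compressedPower_iff hE hA hEA hr one_pos ht, one_le_div hz]
  · rw [logMajorized_congr_charpoly hQ (hC _) (hC _) (hC _) hQC rfl,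
      logMajorized_compressedPower_iff hE hA hEA hr ht one_pos, div_le_one hz]
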